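/- Let $n \ge 1$. A deck is a sequence of $2n$ cards, $n$ of colour $0$ and $n$ of colour $1$, where two decks that differ by exchanging the two colours are identified; every deck is represented by the sequence whose top card has colour $0$. Consider the following Markov chain on decks. If the top and the bottom card have different colours, the top card is moved to the bottom. If they have the same colour (the deck is then called an r-deck), the top card is removed and inserted in one of the $2n$ positions, chosen uniformly at random. The resulting deck is recoloured, if necessary, so that its top card has colour $0$. For a deck $D$ let $\lambda_D$ be the expected number of moves until the chain started at $D$ first reaches the alternating deck $0101\cdots01$. A deck is in tier $k$ if it has exactly $n-k$ blocks (maximal runs of consecutive equal cards) of colour $1$. Let $M_k$ be the maximum of $\lambda_D$ over all decks $D$ in tier $k$, let $M^{\mathrm r}_k$ be the maximum of $\lambda_D$ over all r-decks $D$ in tier $k$, and let $H_k=\sum_{i=1}^k \frac1i$. Then for all integers $k$ with $1\le k<n$ the quantities $M^{\mathrm r}_k$ and $M_k$ are finite, and \[ M^{\mathrm r}_k \le 2n^2H_k-n^2-n\left(k-\tfrac83\right), \qquad M_k \le 2n^2H_k-n^2-n\left(k-\tfrac{14}3\right)-2k-1 . \] -/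

import Mathlib

open MeasureTheory ProbabilityTheory
open scoped ENNReal

namespace CardShuffle

/-- A deck of `2n` cards, listed from top to bottom, with `n` cards of colour `0` (`false`) and
`n` cards of colour `1` (`true`). Two decks that differ by exchanging the colours are identified,
and each such pair is represented by its member whose top card has colour `0`. -/
@[ext] structure Deck (n : ℕ) where
  cards : List Bool
  count_false : cards.count false = n
  count_true : cards.count true = n
  head_eq : cards.head? = some false

namespace Deck

/-- Exchange the two colours if the top card has colour `1`. -/
def foldCards (l : List Bool) : List Bool :=
  if l.head? = some true then l.map (fun b => !b) else l

lemma count_map_not (l : List Bool) (b : Bool) :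
    (l.map (fun c => !c)).count b = l.count (!b) := by
  induction l with
  | nil => rfl
  | cons a l ih => cases a <;> cases b <;> simp_all

lemma count_foldCards {n : ℕ} {l : List Bool} (h0 : l.count false = n) (h1 : l.count true = n)
    (b : Bool) : (foldCards l).count b = n := by
  unfold foldCards
  split_ifs
  · rw [count_map_not]; cases b <;> simpa
  · cases b <;> simpa

lemma head_foldCards {l : List Bool} (h : l ≠ []) : (foldCards l).head? = some false := by
  cases l with
  | nil => exact absurd rfl h
  | cons a l => cases a <;> simp [foldCards]

lemma cards_ne_nil {n : ℕ} (D : Deck n) : D.cards ≠ [] := by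
  intro h
  have := D.head_eq
  simp [h] at this

lemma length_cards {n : ℕ} (D : Deck n) : D.cards.length = 2 * n := by
  have := List.count_false_add_count_true D.cards
  have h0 := D.count_false
  have h1 := D.count_true
  omega

/-- The deck represented by a reordering `l` of the cards of `D`. -/
def reorder {n : ℕ} (D : Deck n) (l : List Bool) (h : l.Perm D.cards) : Deck n where
  cards := foldCards l
  count_false := count_foldCards ((h.count_eq _).trans D.count_false)
    ((h.count_eq _).trans D.count_true) false
  count_true := count_foldCards ((h.count_eq _).trans D.count_false)
    ((h.count_eq _).trans D.count_true) true
  head_eq := head_foldCards fun h' => D.cards_ne_nil (by subst h'; exact h.symm.eq_nil)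

/-- The top card is moved to the bottom of the deck. -/
def topToBottom {n : ℕ} (D : Deck n) : Deck n :=
  D.reorder (D.cards.rotate 1) (List.rotate_perm _ _)

lemma insert_perm {n : ℕ} (D : Deck n) (j : Fin (2 * n)) :
    (D.cards.tail.insertIdx j (D.cards.head D.cards_ne_nil)).Perm D.cards := by
  have hl : (j : ℕ) ≤ D.cards.tail.length := by
    have := D.length_cards
    have := j.isLt
    rw [List.length_tail]
    omega
  have h := List.perm_insertIdx (D.cards.head D.cards_ne_nil) D.cards.tail hl
  rwa [List.cons_head_tail] at h

/-- The top card is removed and put back so that it has exactly `j` cards above it. -/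
def insertTop {n : ℕ} (D : Deck n) (j : Fin (2 * n)) : Deck n :=
  D.reorder (D.cards.tail.insertIdx j (D.cards.head D.cards_ne_nil)) (D.insert_perm j)

/-- A random deck: the top and the bottom card have the same colour. -/
def IsRandom {n : ℕ} (D : Deck n) : Prop :=
  D.cards.head? = D.cards.getLast?

instance {n : ℕ} (D : Deck n) : Decidable D.IsRandom :=
  inferInstanceAs (Decidable (_ = _))

/-- The blocks of a deck: its maximal runs of consecutive cards of a single colour. -/
def blocks {n : ℕ} (D : Deck n) : List (List Bool) :=
  D.cards.splitBy (fun a b => a == b)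

/-- The number of blocks consisting of cards of colour `1`. -/
def numOneBlocks {n : ℕ} (D : Deck n) : ℕ :=
  D.blocks.countP (fun b => true ∈ b)

/-- A deck is in tier `k` if it has exactly `n - k` blocks of cards of colour `1`. -/
def InTier {n : ℕ} (k : ℕ) (D : Deck n) : Prop :=
  D.numOneBlocks + k = n

lemma cards_injective (n : ℕ) : Function.Injective (cards : Deck n → List Bool) :=
  fun _ _ h => Deck.ext h

instance (n : ℕ) : Finite (Deck n) := by
  have : Finite {l : List Bool // l.length = 2 * n} :=
    (List.finite_length_eq Bool (2 * n)).to_subtype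
  exact Finite.of_injective
    (fun D : Deck n => (⟨D.cards, D.length_cards⟩ : {l : List Bool // l.length = 2 * n}))
    fun D D' h => cards_injective n (Subtype.ext_iff.mp h)

instance (n : ℕ) : MeasurableSpace (Deck n) := ⊤

instance (n : ℕ) : DiscreteMeasurableSpace (Deck n) := ⟨fun _ => trivial⟩

/-- The colour sequence `0101…01`, with `n` repetitions of `01`. -/
def alternatingCards : ℕ → List Bool
  | 0 => []
  | n + 1 => false :: true :: alternatingCards n

lemma count_alternatingCards (n : ℕ) (b : Bool) : (alternatingCards n).count b = n := by
  induction n with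
  | zero => rfl
  | succ n ih => cases b <;> simp [alternatingCards, ih]

/-- The alternating deck `0101…01`. -/
def alternating (n : ℕ) [NeZero n] : Deck n where
  cards := alternatingCards n
  count_false := count_alternatingCards n false
  count_true := count_alternatingCards n true
  head_eq := by
    obtain ⟨m, rfl⟩ := Nat.exists_eq_succ_of_ne_zero (NeZero.ne n)
    rfl

/-- The distribution of the deck after one move: if the top and the bottom card have the same
colour, the top card is inserted in one of the `2n` positions, uniformly at random; otherwise the
top card is moved to the bottom. -/
noncomputable def move {n : ℕ} [NeZero n] (D : Deck n) : PMF (Deck n) :=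
  if D.IsRandom then (PMF.uniformOfFintype (Fin (2 * n))).map D.insertTop
  else PMF.pure D.topToBottom

end Deck

/-- The transition kernel of the Markov chain of decks. -/
noncomputable def moveKernel (n : ℕ) [NeZero n] : Kernel (Deck n) (Deck n) :=
  Kernel.ofFunOfCountable fun D => D.move.toMeasure

instance (n : ℕ) [NeZero n] : IsMarkovKernel (moveKernel n) :=
  ⟨fun D => inferInstanceAs (IsProbabilityMeasure D.move.toMeasure)⟩

/-- The law of the next deck given the decks at times `0, …, t`: one move from the deck at
time `t`. -/
noncomputable def historyKernel (n : ℕ) [NeZero n] (t : ℕ) :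
    Kernel ((i : Finset.Iic t) → (fun _ : ℕ => Deck n) i) ((fun _ : ℕ => Deck n) (t + 1)) :=
  (moveKernel n).comap (fun x => x ⟨t, Finset.mem_Iic.mpr le_rfl⟩) (measurable_pi_apply _)

instance (n : ℕ) [NeZero n] (t : ℕ) : IsMarkovKernel (historyKernel n t) :=
  inferInstanceAs (IsMarkovKernel ((moveKernel n).comap _ _))

/-- The law, on sequences of decks, of the Markov chain started at `D`. -/
noncomputable def chainLaw {n : ℕ} [NeZero n] (D : Deck n) : Measure (ℕ → Deck n) :=
  Kernel.traj (historyKernel n) 0 (fun _ => D)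

/-- The number of moves until a sequence of decks first reaches the alternating deck (`∞` if it
never does). -/
noncomputable def absorptionTime {n : ℕ} [NeZero n] (ω : ℕ → Deck n) : ℝ≥0∞ :=
  ⨅ (t : ℕ) (_ : ω t = Deck.alternating n), (t : ℝ≥0∞)

/-- The expected number of moves to go from `D` to the alternating deck. -/
noncomputable def expectedTime {n : ℕ} [NeZero n] (D : Deck n) : ℝ≥0∞ :=
  ∫⁻ ω, absorptionTime ω ∂(chainLaw D)

/-- The maximum of the expected absorption time over the decks in tier `k`. -/
noncomputable def maxTime (n k : ℕ) [NeZero n] : ℝ≥0∞ :=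
  ⨆ (D : Deck n) (_ : D.InTier k), expectedTime D

/-- The maximum of the expected absorption time over the random decks in tier `k`. -/
noncomputable def maxRandomTime (n k : ℕ) [NeZero n] : ℝ≥0∞ :=
  ⨆ (D : Deck n) (_ : D.InTier k ∧ D.IsRandom), expectedTime D

end CardShuffle

/-!
The expected absorption time is bounded by a potential: a function of the deck that, away from the
alternating deck, drops on average by at least one per move
(`CardShuffle.expectedTime_le_of_superharmonic`, which follows from the Markov property of the
chain).

Up to an exchange of colours a deck is its cyclic adjacency word, which records for each card
whether it has the colour of the card before it (`cyc`, with entry `true` for equal neighbours). A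
deck is random when the word starts with `true`, a move to the bottom rotates the word, and a
tier-`k` deck has `2 * k` entries `true`, half of them in each colour. Let `p` be the number of
entries `false` before the first `true`, and `q` the number between the first and the second. The
potential on tier `k` is `p + C k + q / 2 - c k * q ^ 2` (`pot`): the moves before the next random
deck, plus a quantity attached to that deck.

At a random deck write the word as `true :: w`, with `d` entries `false` before the first `true`
of `w`. Inserting the top card where it leaves the tier unchanged inserts `true` in `w` with some
even number `f` of entries `false` above it. The next random deck is then `min f d` moves away, and
its own distance `q` to the next pair is at most `|f - d|`. Since
`min f d + |f - d| / 2 = (f + d) / 2`, these insertions add up to an explicit sum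
(`pot_insert_le`, `sum_insert_le`, `sum_insertBound`). The remaining `k` of the `2 * n`
insertions fall inside blocks of colour `1` and lower the tier by one (`pot_drop_le`). For `2 ≤ k`
the potential then drops by about `2 * n ^ 2 / k - n`, which pays for the time spent on tier `k`
even with `c k = 0` (`base_step`). On tier `1`, where such an insertion ends the process, the bound
on `q` is attained and more care is needed: `(f - d) ^ 2` involves no absolute value, and the
quadratic correction cancels the terms linear in `d`. Both cases are carried out in
`pot_random_step`. Finally `p < 2 * (n - k)`, `q < 2 * (n - k)` at random decks,
because the colours are balanced (`Deck.lead_lt_count`, `count_of_lead_eq`), and this turns the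
potential into the two stated bounds.
-/

namespace CardShuffle

/-! ### Superharmonic bounds on the expected absorption time -/

lemma measurable_eval {n : ℕ} (t : ℕ) : Measurable fun ω : ℕ → Deck n => ω t :=
  measurable_pi_apply t

section

variable {n : ℕ} [NeZero n]

/-- The trajectories that avoid the alternating deck up to time `t`. -/
def aliveSet (n : ℕ) [NeZero n] (t : ℕ) : Set (ℕ → Deck n) :=
  {ω | ∀ s ≤ t, ω s ≠ Deck.alternating n}

lemma measurableSet_aliveSet (t : ℕ) : MeasurableSet (aliveSet n t) := by
  have : aliveSet n t =
      ⋂ s, ⋂ (_ : s ≤ t), (fun ω : ℕ → Deck n => ω s) ⁻¹' {Deck.alternating n}ᶜ := by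
    ext ω
    simp [aliveSet]
  rw [this]
  exact MeasurableSet.iInter fun s => MeasurableSet.iInter fun _ =>
    measurable_eval s (MeasurableSet.of_discrete)

/-- The Markov property of the chain, in the form of an integral over one further move. -/
lemma lintegral_chainLaw_succ (D : Deck n) (t : ℕ)
    (G : ((i : Finset.Iic t) → (fun _ : ℕ => Deck n) i) → ℝ≥0∞) (hG : Measurable G)
    (f : Deck n → ℝ≥0∞) :
    ∫⁻ ω, G (Preorder.frestrictLe t ω) * f (ω (t + 1)) ∂(chainLaw D) =
      ∫⁻ ω, G (Preorder.frestrictLe t ω) * ∫⁻ E, f E ∂(moveKernel n (ω t)) ∂(chainLaw D) := by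
  have hf : Measurable f := Measurable.of_discrete
  have hK : Measurable fun E => ∫⁻ E', f E' ∂(moveKernel n E) := Measurable.of_discrete
  have key := Kernel.partialTraj_compProd_eq_map_traj (X := fun _ => Deck n) (κ := historyKernel n)
    (a := 0) (b := t)
    (zero_le) (x₀ := fun _ => D)
  have hH : Measurable fun p : ((i : Finset.Iic t) → (fun _ : ℕ => Deck n) i) × Deck n =>
      G p.1 * f p.2 := (hG.comp measurable_fst).mul (hf.comp measurable_snd)
  have h1 : ∫⁻ ω, G (Preorder.frestrictLe t ω) * f (ω (t + 1)) ∂(chainLaw D) =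
      ∫⁻ p, G p.1 * f p.2 ∂((chainLaw D).map
        (fun x => (Preorder.frestrictLe t x, x (t + 1)))) := by
    rw [lintegral_map hH (by fun_prop)]
  rw [h1, chainLaw, ← key, Measure.lintegral_compProd hH,
    ← Kernel.traj_map_frestrictLe_apply]
  have hHH : Measurable fun x : ((i : Finset.Iic t) → (fun _ : ℕ => Deck n) i) =>
      ∫⁻ E, G x * f E ∂(historyKernel n t x) := by
    have : ∀ x, ∫⁻ E, G x * f E ∂(historyKernel n t x) =
        G x * ∫⁻ E, f E ∂(moveKernel n (x ⟨t, Finset.mem_Iic.mpr le_rfl⟩)) := fun x =>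
      lintegral_const_mul _ hf
    simp_rw [this]
    exact hG.mul (hK.comp (measurable_pi_apply _))
  rw [lintegral_map hHH (by fun_prop)]
  refine lintegral_congr fun ω => ?_
  exact lintegral_const_mul _ hf

lemma lintegral_chainLaw_zero (D : Deck n) (f : Deck n → ℝ≥0∞) :
    ∫⁻ ω, f (ω 0) ∂(chainLaw D) = f D := by
  have hf : Measurable f := Measurable.of_discrete
  have hH : Measurable fun x : ((i : Finset.Iic 0) → (fun _ : ℕ => Deck n) i) =>
      f (x ⟨0, Finset.mem_Iic.mpr le_rfl⟩) := hf.comp (measurable_pi_apply _)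
  have h1 : ∫⁻ ω, f (ω 0) ∂(chainLaw D) =
      ∫⁻ x, f (x ⟨0, Finset.mem_Iic.mpr le_rfl⟩) ∂((chainLaw D).map (Preorder.frestrictLe 0)) := by
    rw [lintegral_map hH (by fun_prop)]
    rfl
  rw [h1, chainLaw, Kernel.traj_map_frestrictLe_apply, Kernel.partialTraj_self, Kernel.id_apply,
    lintegral_dirac' _ hH]

lemma absorptionTime_le_tsum (ω : ℕ → Deck n) :
    absorptionTime ω ≤ ∑' t, (aliveSet n t).indicator 1 ω := by
  by_cases h : ∃ t, ω t = Deck.alternating n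
  · classical
    calc absorptionTime ω ≤ (Nat.find h : ℝ≥0∞) := iInf₂_le (Nat.find h) (Nat.find_spec h)
      _ = ∑ t ∈ Finset.range (Nat.find h),
          (aliveSet n t).indicator (1 : (ℕ → Deck n) → ℝ≥0∞) ω := by
        rw [Finset.sum_congr rfl (g := fun _ => (1 : ℝ≥0∞))]
        · simp
        · intro t ht
          have hmem : ω ∈ aliveSet n t := fun s hs =>
            Nat.find_min h (lt_of_le_of_lt hs (Finset.mem_range.mp ht))
          exact Set.indicator_of_mem hmem _
      _ ≤ _ := ENNReal.sum_le_tsum _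
  · push Not at h
    have : ∀ t, (aliveSet n t).indicator (1 : (ℕ → Deck n) → ℝ≥0∞) ω = 1 := fun t =>
      Set.indicator_of_mem (show ω ∈ aliveSet n t from fun s _ => h s) _
    simp [this]

/-- A function that, away from the alternating deck, drops on average by at least one per move
dominates the expected absorption time. -/
theorem expectedTime_le_of_superharmonic (f : Deck n → ℝ≥0∞)
    (hf : ∀ D, D ≠ Deck.alternating n → 1 + ∫⁻ E, f E ∂(moveKernel n D) ≤ f D) (D : Deck n) :
    expectedTime D ≤ f D := by
  have hfm : Measurable f := Measurable.of_discrete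
  have hK : Measurable fun E => ∫⁻ E', f E' ∂(moveKernel n E) := Measurable.of_discrete
  set a : ℕ → ℝ≥0∞ := fun t => ∫⁻ ω, (aliveSet n t).indicator 1 ω * f (ω t) ∂(chainLaw D)
    with ha
  have hind : ∀ t, Measurable ((aliveSet n t).indicator (1 : (ℕ → Deck n) → ℝ≥0∞)) := fun t =>
    measurable_one.indicator (measurableSet_aliveSet t)
  -- While the chain is alive, the time spent plus the potential decreases on average.
  have step : ∀ t, (chainLaw D) (aliveSet n t) + a (t + 1) ≤ a t := by
    intro t
    set S : Set ((i : Finset.Iic t) → (fun _ : ℕ => Deck n) i) :=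
      {x | ∀ i, x i ≠ Deck.alternating n}
    have hS : MeasurableSet S := by
      have : S = ⋂ i, (fun x : (i : Finset.Iic t) → (fun _ : ℕ => Deck n) i => x i) ⁻¹'
          {Deck.alternating n}ᶜ := by
        ext x
        simp [S]
      rw [this]
      exact MeasurableSet.iInter fun i => measurable_pi_apply i (MeasurableSet.of_discrete)
    have hSω : ∀ ω : ℕ → Deck n,
        S.indicator (1 : ((i : Finset.Iic t) → (fun _ : ℕ => Deck n) i) → ℝ≥0∞)
          (Preorder.frestrictLe t ω) =
        (aliveSet n t).indicator 1 ω := by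
      intro ω
      have : Preorder.frestrictLe (π := fun _ => Deck n) t ω ∈ S ↔ ω ∈ aliveSet n t := by
        simp [S, aliveSet]
      by_cases h : ω ∈ aliveSet n t
      · rw [Set.indicator_of_mem h, Set.indicator_of_mem (this.2 h)]; rfl
      · rw [Set.indicator_of_notMem h, Set.indicator_of_notMem (fun h' => h (this.1 h'))]
    have h1 : a (t + 1) ≤
        ∫⁻ ω, (aliveSet n t).indicator 1 ω * ∫⁻ E, f E ∂(moveKernel n (ω t)) ∂(chainLaw D) := by
      have := lintegral_chainLaw_succ D t (S.indicator 1) (measurable_one.indicator hS) f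
      simp_rw [hSω] at this
      rw [← this]
      refine lintegral_mono fun ω => mul_le_mul_left (Set.indicator_le_indicator_of_subset ?_
        (fun _ => zero_le) ω) _
      exact fun ω h s hs => h s (hs.trans (Nat.le_succ t))
    have h2 : (chainLaw D) (aliveSet n t) = ∫⁻ ω, (aliveSet n t).indicator 1 ω ∂(chainLaw D) :=
      (lintegral_indicator_one (measurableSet_aliveSet t)).symm
    rw [h2]
    refine (add_le_add_right h1 _).trans ?_
    rw [← lintegral_add_left (hind t)]
    refine lintegral_mono fun ω => ?_
    by_cases h : ω ∈ aliveSet n t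
    · simp only [Set.indicator_of_mem h, Pi.one_apply, one_mul]
      exact hf _ (h t le_rfl)
    · simp [Set.indicator_of_notMem h]
  have partialSum : ∀ N, ∑ t ∈ Finset.range N, (chainLaw D) (aliveSet n t) + a N ≤ a 0 := by
    intro N
    induction N with
    | zero => simp
    | succ N ih =>
      rw [Finset.sum_range_succ, add_assoc]
      exact (add_le_add_right (step N) _).trans ih
  calc expectedTime D ≤ ∫⁻ ω, ∑' t, (aliveSet n t).indicator 1 ω ∂(chainLaw D) :=
        lintegral_mono absorptionTime_le_tsum
    _ = ∑' t, (chainLaw D) (aliveSet n t) := by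
        rw [lintegral_tsum fun t => (hind t).aemeasurable]
        exact tsum_congr fun t => lintegral_indicator_one (measurableSet_aliveSet t)
    _ ≤ a 0 := by
        rw [ENNReal.tsum_eq_iSup_nat]
        exact iSup_le fun N => le_self_add.trans (partialSum N)
    _ ≤ ∫⁻ ω, f (ω 0) ∂(chainLaw D) := by
        refine lintegral_mono fun ω => ?_
        by_cases h : ω ∈ aliveSet n 0
        · simp [Set.indicator_of_mem h]
        · simp [Set.indicator_of_notMem h]
    _ = f D := lintegral_chainLaw_zero D f

/-- The mean of a function after one move from a random deck is the average over the positions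
in which the top card can be inserted. -/
lemma lintegral_moveKernel_of_isRandom (f : Deck n → ℝ≥0∞) {D : Deck n} (hD : D.IsRandom) :
    ∫⁻ E, f E ∂(moveKernel n D) = (∑ j : Fin (2 * n), f (D.insertTop j)) / (2 * n : ℕ) := by
  have hf : Measurable f := Measurable.of_discrete
  have : Nonempty (Fin (2 * n)) := ⟨⟨0, by have := NeZero.pos n; omega⟩⟩
  have h : moveKernel n D = ((PMF.uniformOfFintype (Fin (2 * n))).toMeasure).map D.insertTop := by
    change D.move.toMeasure = _
    rw [Deck.move, if_pos hD, PMF.toMeasure_map _ (hf := Measurable.of_discrete)]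
  rw [h, lintegral_map hf Measurable.of_discrete, lintegral_fintype, ENNReal.div_eq_inv_mul,
    Finset.mul_sum]
  refine Finset.sum_congr rfl fun j _ => ?_
  rw [PMF.toMeasure_apply_singleton _ _ (MeasurableSet.singleton j),
    PMF.uniformOfFintype_apply, Fintype.card_fin, mul_comm]

lemma lintegral_moveKernel_of_not_isRandom (f : Deck n → ℝ≥0∞) {D : Deck n}
    (hD : ¬ D.IsRandom) : ∫⁻ E, f E ∂(moveKernel n D) = f D.topToBottom := by
  have h : moveKernel n D = Measure.dirac D.topToBottom := by
    change D.move.toMeasure = _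
    rw [Deck.move, if_neg hD, PMF.toMeasure_pure]
  rw [h, lintegral_dirac]

end

/-! ### Adjacency words -/

/-- The adjacency word of `a :: l`: its entries record, for each card of `l`, whether it has the
colour of the card just before it. -/
def adj : Bool → List Bool → List Bool
  | _, [] => []
  | a, b :: l => (a == b) :: adj b l

/-- The bottom card of the deck `a :: l`. -/
def bottom : Bool → List Bool → Bool
  | a, [] => a
  | _, b :: l => bottom b l

/-- The cyclic adjacency word of a deck, in which the top card is compared with the bottom card. -/
def cyc (c : List Bool) : List Bool := adj (bottom false c) c

/-- The number of pairs of consecutive cards in `a :: l` both of which have colour `c`. -/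
def pairs (c : Bool) : Bool → List Bool → ℕ
  | _, [] => 0
  | a, b :: l => (if a = c ∧ b = c then 1 else 0) + pairs c b l

lemma length_adj (a : Bool) (l : List Bool) : (adj a l).length = l.length := by
  induction l generalizing a with
  | nil => rfl
  | cons b l ih => simp [adj, ih]

lemma bottom_append (l₁ l₂ : List Bool) (a : Bool) :
    bottom a (l₁ ++ l₂) = bottom (bottom a l₁) l₂ := by
  induction l₁ generalizing a with
  | nil => rfl
  | cons b l ih => exact ih b

lemma adj_append (a : Bool) (l₁ l₂ : List Bool) :
    adj a (l₁ ++ l₂) = adj a l₁ ++ adj (bottom a l₁) l₂ := by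
  induction l₁ generalizing a with
  | nil => rfl
  | cons b l ih => simp [adj, bottom, ih b]

lemma adj_map_not (a : Bool) (l : List Bool) : adj (!a) (l.map (fun b => !b)) = adj a l := by
  induction l generalizing a with
  | nil => rfl
  | cons b l ih =>
    have : ((!a) == (!b)) = (a == b) := by cases a <;> cases b <;> rfl
    simp [adj, ih, this]

lemma cyc_foldCards (l : List Bool) : cyc (Deck.foldCards l) = cyc l := by
  unfold Deck.foldCards
  split_ifs with h
  · cases l with
    | nil => rfl
    | cons x l =>
      have : bottom false ((x :: l).map (fun b => !b)) = !(bottom false (x :: l)) := by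
        clear h
        induction l generalizing x with
        | nil => rfl
        | cons b l ih => exact ih b
      rw [cyc, this, adj_map_not, cyc]
  · rfl

lemma cyc_cons (x : Bool) (l : List Bool) :
    cyc (x :: l) = (bottom x l == x) :: adj x l := by
  rfl

/-- Moving the top card to the bottom rotates the cyclic adjacency word. -/
lemma cyc_rotate (x : Bool) (l : List Bool) :
    cyc (l ++ [x]) = adj x l ++ [bottom x l == x] := by
  rw [cyc, bottom_append, adj_append]
  rcases List.eq_nil_or_concat l with rfl | ⟨l, b, rfl⟩
  · simp [adj, bottom]
  · simp [adj, adj_append, bottom, bottom_append]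

lemma pairs_add_pairs (a : Bool) (l : List Bool) :
    pairs false a l + pairs true a l = (adj a l).count true := by
  induction l generalizing a with
  | nil => rfl
  | cons b l ih =>
    have := ih b
    cases a <;> cases b <;> simp [adj, pairs] <;> omega

/-- Each card of colour `c` follows a card of the same colour or a change of colour, and the changes
lead to the two colours alternately. -/
lemma two_mul_count_add (c a : Bool) (l : List Bool) :
    2 * l.count c + (a == c).toNat =
      2 * pairs c a l + (adj a l).count false + (bottom a l == c).toNat := by
  induction l generalizing a with
  | nil => simp [adj, pairs, bottom]
  | cons b l ih =>
    have := ih b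
    simp only [adj, pairs, bottom]
    generalize bottom b l = z at *
    cases a <;> cases b <;> cases c <;> cases z <;> simp at this ⊢ <;> omega

/-! ### The first two equal neighbours -/

/-- The number of entries `false` at the start of an adjacency word: the number of moves to the
bottom that precede the next random move. -/
def lead : List Bool → ℕ
  | [] => 0
  | true :: _ => 0
  | false :: v => lead v + 1

/-- The part of an adjacency word after its first entry `true`. -/
def afterFirst : List Bool → List Bool
  | [] => []
  | true :: v => v
  | false :: v => afterFirst v

lemma lead_append_of_mem {u : List Bool} (h : true ∈ u) (v : List Bool) :
    lead (u ++ v) = lead u := by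
  induction u with
  | nil => simp at h
  | cons b u ih =>
    cases b
    · simp only [List.cons_append, lead]
      rw [ih (by simpa using h)]
    · rfl

lemma afterFirst_append_of_mem {u : List Bool} (h : true ∈ u) (v : List Bool) :
    afterFirst (u ++ v) = afterFirst u ++ v := by
  induction u with
  | nil => simp at h
  | cons b u ih =>
    cases b
    · exact ih (by simpa using h)
    · rfl

lemma lead_append_of_notMem {u : List Bool} (h : true ∉ u) (v : List Bool) :
    lead (u ++ v) = u.count false + lead v := by
  induction u with
  | nil => simp
  | cons b u ih =>
    cases b
    · simp only [List.cons_append, lead, List.count_cons_self]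
      rw [ih (by simpa using h)]
      ring
    · simp at h

lemma afterFirst_append_of_notMem {u : List Bool} (h : true ∉ u) (v : List Bool) :
    afterFirst (u ++ v) = afterFirst v := by
  induction u with
  | nil => rfl
  | cons b u ih =>
    cases b
    · exact ih (by simpa using h)
    · simp at h

lemma lead_append_true_le (u v : List Bool) : lead (u ++ true :: v) ≤ u.count false := by
  induction u with
  | nil => simp [lead]
  | cons b u ih => cases b <;> simp [lead]; omega

lemma lead_le_count (v : List Bool) : lead v ≤ v.count false := by
  induction v with
  | nil => simp [lead]
  | cons b v ih => cases b <;> simp [lead]; omega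

lemma lead_add_count_afterFirst {v : List Bool} (h : true ∈ v) :
    lead v + (afterFirst v).count false = v.count false := by
  induction v with
  | nil => simp at h
  | cons b v ih =>
    cases b
    · have := ih (by simpa using h)
      simp [lead, afterFirst]
      omega
    · simp [lead, afterFirst]

lemma count_true_afterFirst {v : List Bool} (h : true ∈ v) :
    (afterFirst v).count true + 1 = v.count true := by
  induction v with
  | nil => simp at h
  | cons b v ih =>
    cases b
    · have := ih (by simpa using h)
      simp [afterFirst]
      omega
    · simp [afterFirst]

lemma lead_add_lead_afterFirst_le {v : List Bool} (h : true ∈ v) :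
    lead v + lead (afterFirst v) ≤ v.count false := by
  have := lead_le_count (afterFirst v)
  have := lead_add_count_afterFirst h
  omega

/-- If all colour changes come before the first pair of equal neighbours, the cards alternate up to
that pair and have a single colour from then on, so that this colour is in excess by the number of
pairs. The parity of the number of changes tells which colour it is. -/
lemma count_of_lead_eq (a : Bool) (l : List Bool) (h : lead (adj a l) = (adj a l).count false) :
    (Even ((adj a l).count false) → l.count a = l.count (!a) + (adj a l).count true) ∧
    (¬ Even ((adj a l).count false) → l.count (!a) = l.count a + 1 + (adj a l).count true) := by
  induction l generalizing a with
  | nil => simp [adj]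
  | cons b l ih =>
    by_cases hab : a = b
    · subst hab
      have h0 : (adj a l).count false = 0 := by simpa [adj, lead] using h.symm
      have hl : l.count (!a) = 0 ∧ l.count a = (adj a l).count true := by
        clear h ih
        induction l generalizing a with
        | nil => simp [adj]
        | cons b l ih =>
          by_cases hab : a = b
          · subst hab
            have := ih a (by simpa [adj] using h0)
            cases a <;> simp_all [adj]
          · cases a <;> cases b <;> simp_all [adj]
      constructor
      · intro _
        cases a <;> simp_all [adj]
      · intro h'
        exact absurd (by simp [adj, h0]) h'
    · obtain rfl : b = !a := by cases a <;> cases b <;> simp_all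
      have hfl : (a == !a) = false := by cases a <;> rfl
      have h' : lead (adj (!a) l) = (adj (!a) l).count false := by
        simpa [adj, hfl, lead] using h
      obtain ⟨h1, h2⟩ := ih (!a) h'
      simp only [adj, hfl, List.count_cons_self, Nat.even_add_one, not_not]
      constructor
      · intro hev
        have := h2 hev
        cases a <;> simp at this ⊢ <;> omega
      · intro hev
        have := h1 hev
        cases a <;> simp at this ⊢ <;> omega

/-- A word without pairs of equal neighbours alternates. -/
lemma eq_of_adj_count_true_eq_zero {a : Bool} {l l' : List Bool} (h : (adj a l).count true = 0)
    (h' : (adj a l').count true = 0) (hlen : l.length = l'.length) : l = l' := by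
  induction l generalizing a l' with
  | nil => exact (List.eq_nil_of_length_eq_zero hlen.symm).symm
  | cons b l ih =>
    cases l' with
    | nil => simp at hlen
    | cons b' l' =>
      have hb : b = b' := by cases a <;> cases b <;> cases b' <;> simp_all [adj]
      subst hb
      have h1 : (adj b l).count true = 0 := by cases a <;> cases b <;> simp_all [adj]
      have h2 : (adj b l').count true = 0 := by cases a <;> cases b <;> simp_all [adj]
      rw [ih h1 h2 (by simpa using hlen)]

/-! ### Summing over the positions of the inserted card -/

/-- Summing a bound over all positions of a card of colour `0` inserted in `false :: l`. The
positions just before and just after a card of colour `0` give the same deck (`h2`), so that every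
position may be taken either to follow a card of colour `0` (`h1`) or to lie inside a block of
colour `1` (`h3`). A position at a change of colour is charged `Ψ` of the number of earlier
changes, rounded up to an even number; the positions inside blocks are charged `Z` or `X` according
to the colour. The induction on the cards `l₂` below the position moves one card at a time to the
cards `l₁` above it. -/
lemma sum_insert_le {l : List Bool} (G : List Bool → List Bool → ℝ) (Ψ : ℕ → ℝ) (X Z : ℝ)
    (h1 : ∀ l₁ l₂, l = l₁ ++ l₂ → bottom false l₁ = false →
      G l₁ l₂ ≤ Ψ ((adj false l₁).count false))
    (h2 : ∀ l₁ l₂, G l₁ (false :: l₂) = G (l₁ ++ [false]) l₂)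
    (h3 : ∀ l₁ l₂, l = l₁ ++ true :: l₂ → bottom false l₁ = true → G l₁ (true :: l₂) ≤ X)
    (h4 : ∀ f, f ≤ (adj false l).count false → Ψ f ≤ Z)
    (hlast : bottom false l = false) (l₁ l₂ : List Bool) (hl : l = l₁ ++ l₂) :
    ∑ j ∈ Finset.range (l₂.length + 1), G (l₁ ++ l₂.take j) (l₂.drop j) ≤
      ∑ f ∈ Finset.Ico ((adj false l₁).count false) ((adj false l).count false),
        Ψ (2 * ((f + 1) / 2)) + Ψ ((adj false l).count false) +
      pairs false (bottom false l₁) l₂ * Z + pairs true (bottom false l₁) l₂ * X := by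
  induction l₂ generalizing l₁ with
  | nil =>
    have hl' : l₁ = l := by simpa using hl.symm
    subst hl'
    simpa [pairs] using h1 l₁ [] hl hlast
  | cons b l₂ ih =>
    have hl' : l = (l₁ ++ [b]) ++ l₂ := by simp [hl]
    have ih' := ih (l₁ ++ [b]) hl'
    rw [List.length_cons, Finset.sum_range_succ']
    have hsum : ∑ j ∈ Finset.range (l₂.length + 1),
          G (l₁ ++ (b :: l₂).take (j + 1)) ((b :: l₂).drop (j + 1)) =
        ∑ j ∈ Finset.range (l₂.length + 1), G (l₁ ++ [b] ++ l₂.take j) (l₂.drop j) := by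
      simp
    rw [hsum]
    have hfl : (adj false (l₁ ++ [b])).count false =
        (adj false l₁).count false + (if bottom false l₁ = b then 0 else 1) := by
      rw [adj_append]
      cases bottom false l₁ <;> cases b <;> simp [adj]
    have hle : (adj false (l₁ ++ [b])).count false ≤ (adj false l).count false := by
      rw [hl', adj_append _ (l₁ ++ [b]), List.count_append]
      omega
    have hpar := two_mul_count_add true false l₁
    have htt : (true == true).toNat = 1 := rfl
    have hft : (false == true).toNat = 0 := rfl
    have hG0 : G (l₁ ++ (b :: l₂).take 0) ((b :: l₂).drop 0) = G l₁ (b :: l₂) := by simp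
    rw [hG0]
    rw [hfl] at hle ih'
    have hlastb : bottom false (l₁ ++ [b]) = b := by simp [bottom_append, bottom]
    rw [hlastb] at ih'
    -- A colour change moves the lower end of the range of `f` up by one.
    have hIco : ∀ f, f + 1 ≤ (adj false l).count false →
        ∑ f ∈ Finset.Ico f ((adj false l).count false), Ψ (2 * ((f + 1) / 2)) =
          Ψ (2 * ((f + 1) / 2)) +
          ∑ f ∈ Finset.Ico (f + 1) ((adj false l).count false), Ψ (2 * ((f + 1) / 2)) :=
      fun f hf => Finset.sum_eq_sum_Ico_succ_bot (by omega) _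
    set f := (adj false l₁).count false with hf
    rcases ha : bottom false l₁ with _ | _ <;> rcases b with _ | _ <;>
      simp only [ha, pairs, if_true, reduceCtorEq, if_false, and_self, and_false, and_true,
        Nat.cast_add, Nat.cast_one, add_zero, zero_add]
        at ih' hle hpar ⊢
    · have := h1 l₁ _ hl ha
      have := h4 f hle
      linarith
    · have := h1 l₁ _ hl ha
      rw [hIco f hle]
      have hev : 2 * ((f + 1) / 2) = f := by omega
      rw [hev]
      linarith
    · have h5 := h1 (l₁ ++ [false]) l₂ hl' hlastb
      rw [h2, hIco f hle]
      have hev : 2 * ((f + 1) / 2) = f + 1 := by omega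
      have : (adj false (l₁ ++ [false])).count false = f + 1 := by rw [hfl, ha]; simp
      rw [this] at h5
      rw [hev]
      linarith
    · have := h3 l₁ l₂ hl ha
      linarith

/-! ### The potential -/

/-- The bound for the random decks of tier `k`. -/
noncomputable def tierBound (n k : ℕ) : ℝ :=
  2 * (n : ℝ) ^ 2 * (harmonic k : ℝ) - (n : ℝ) ^ 2 - (n : ℝ) * ((k : ℝ) - 8 / 3)

/-- The constant term of the potential on tier `k`. On tier `1` it is smaller than the general
formula by `5 / 6`; the induction on tiers uses this gain in its first step. -/
noncomputable def base (n k : ℕ) : ℝ :=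
  if k = 1 then (n : ℝ) ^ 2 + 2 * n / 3 + 2 / 3 else tierBound n k - (n - k - 1 / 2)

/-- The coefficient of the quadratic correction to the potential. It is chosen so that, on tier
`1`, the terms linear in the distance cancel in the average over the inserted card. -/
noncomputable def curv (n k : ℕ) : ℝ :=
  if k = 1 then 1 / (8 * n * (n - 1)) else 0

/-- The potential of a random deck of tier `k` in which `q` colour changes separate the top card
from the next pair of equal neighbours. -/
noncomputable def rPot (n k q : ℕ) : ℝ :=
  base n k + q / 2 - curv n k * (q : ℝ) ^ 2

/-- The potential of a deck with cyclic adjacency word `v`: the number of moves up to the next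
random deck plus the potential of that deck. A tier-`k` word has `2 * k` entries `true`. -/
noncomputable def pot (n : ℕ) (v : List Bool) : ℝ :=
  if v.count true = 0 then 0
  else lead v + rPot n (v.count true / 2) (lead (afterFirst v))

lemma curv_nonneg (n k : ℕ) (hn : 2 ≤ n) : 0 ≤ curv n k := by
  unfold curv
  have : (2 : ℝ) ≤ n := by exact_mod_cast hn
  split_ifs
  · have : (0 : ℝ) ≤ n - 1 := by linarith
    positivity
  · rfl

lemma curv_mul_le (n k : ℕ) (hn : 2 ≤ n) : curv n k * (8 * n * (n - 1)) ≤ 1 := by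
  unfold curv
  have : (2 : ℝ) ≤ n := by exact_mod_cast hn
  have : (0 : ℝ) < n - 1 := by linarith
  split_ifs
  · rw [one_div, inv_mul_cancel₀ (by positivity)]
  · simp

lemma rPot_le (n k q : ℕ) (hn : 2 ≤ n) : rPot n k q ≤ base n k + q / 2 := by
  unfold rPot
  have := mul_nonneg (curv_nonneg n k hn) (sq_nonneg (q : ℝ))
  linarith

lemma rPot_mono {n : ℕ} (k : ℕ) (hn : 2 ≤ n) {q q' : ℕ} (h : q ≤ q') (h' : q' ≤ 2 * (n - 1)) :
    rPot n k q ≤ rPot n k q' := by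
  have h0 := curv_nonneg n k hn
  have h1 := curv_mul_le n k hn
  have hn' : (2 : ℝ) ≤ n := by exact_mod_cast hn
  have hq : (q : ℝ) ≤ q' := by exact_mod_cast h
  have hq' : (q' : ℝ) ≤ 2 * (n - 1) := by
    have : ((q' : ℕ) : ℝ) ≤ ((2 * (n - 1) : ℕ) : ℝ) := by exact_mod_cast h'
    rwa [Nat.cast_mul, Nat.cast_sub (by omega), Nat.cast_ofNat, Nat.cast_one] at this
  have h2 : curv n k * (q + q') ≤ 1 / 2 := by
    have : curv n k * (q + q') ≤ curv n k * (4 * (n - 1)) :=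
      mul_le_mul_of_nonneg_left (by linarith) h0
    have : curv n k * (4 * (n - 1)) * 4 ≤ curv n k * (4 * (n - 1)) * (2 * n) :=
      mul_le_mul_of_nonneg_left (by linarith)
        (mul_nonneg h0 (by linarith))
    nlinarith
  unfold rPot
  nlinarith

lemma le_tierBound {n k : ℕ} (hk : 1 ≤ k) :
    (n : ℝ) ^ 2 - n * (k - 8 / 3) ≤ tierBound n k := by
  have h : (1 : ℚ) ≤ harmonic k := by
    calc (1 : ℚ) = harmonic 1 := by simp [harmonic]
      _ ≤ harmonic k := by
        unfold harmonic
        exact Finset.sum_le_sum_of_subset_of_nonneg (Finset.range_mono hk)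
          fun i _ _ => by positivity
  have h' : (1 : ℝ) ≤ (harmonic k : ℝ) := by exact_mod_cast h
  unfold tierBound
  nlinarith [sq_nonneg (n : ℝ)]

lemma one_le_base {n k : ℕ} (hk : 1 ≤ k) (hkn : k < n) : 1 ≤ base n k := by
  have h := le_tierBound (n := n) hk
  have hk' : (1 : ℝ) ≤ k := by exact_mod_cast hk
  have hn : (k : ℝ) + 1 ≤ n := by exact_mod_cast hkn
  unfold base
  split_ifs
  · nlinarith
  · nlinarith

lemma rPot_nonneg {n k q : ℕ} (hk : 1 ≤ k) (hkn : k < n) (hq : q ≤ 2 * n) :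
    0 ≤ rPot n k q := by
  have h0 := curv_nonneg n k (by omega)
  have h1 := curv_mul_le n k (by omega)
  have h2 := one_le_base hk hkn
  have hn : (2 : ℝ) ≤ n := by exact_mod_cast (by omega : 2 ≤ n)
  have hq' : (q : ℝ) ≤ 2 * n := by exact_mod_cast hq
  have hq0 : (0 : ℝ) ≤ q := by positivity
  have h3 : curv n k * (q : ℝ) ^ 2 ≤ 1 := by
    have : (q : ℝ) ^ 2 ≤ 8 * n * (n - 1) := by nlinarith
    exact (mul_le_mul_of_nonneg_left this h0).trans h1
  unfold rPot
  linarith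

lemma pot_nonneg {n : ℕ} {v : List Bool} (hk : v.count true < 2 * n)
    (hlen : v.length ≤ 2 * n) (h2 : v.count true ≠ 1) : 0 ≤ pot n v := by
  unfold pot
  split_ifs with h
  · rfl
  · have hmem : true ∈ v := List.count_pos_iff.1 (Nat.pos_of_ne_zero h)
    have h3 := lead_add_lead_afterFirst_le hmem
    have h4 : v.count false ≤ v.length := List.count_le_length
    have := rPot_nonneg (n := n) (k := v.count true / 2) (q := lead (afterFirst v))
      (by omega) (by omega) (by omega)
    positivity

/-- The potential drops enough between tiers to pay for the moves spent on tier `k`. -/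
lemma base_step {n k : ℕ} (hk : 2 ≤ k) (hkn : k < n) :
    2 * (n : ℝ) + n * (n - k) + k * (base n (k - 1) + 2 * (n - k) + 1) ≤ k * base n k := by
  have hkn' : (k : ℝ) + 1 ≤ n := by exact_mod_cast hkn
  rcases hk.eq_or_lt with rfl | hk3
  · norm_num [base, tierBound, harmonic, Finset.sum_range_succ]
    nlinarith [sq_nonneg ((n : ℝ) - 3)]
  · obtain ⟨j, rfl⟩ : ∃ j, k = j + 1 := ⟨k - 1, by omega⟩
    have hj : j ≠ 1 := by omega
    have hj2 : (2 : ℝ) ≤ j := by exact_mod_cast (by omega : 2 ≤ j)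
    simp only [base, Nat.add_sub_cancel, hj, if_false, show j + 1 ≠ 1 by omega, tierBound,
      harmonic_succ]
    push_cast at hkn' ⊢
    have hpos : (j : ℝ) + 1 ≠ 0 := by positivity
    have hcancel : ((j : ℝ) + 1) * (2 * (n : ℝ) ^ 2 * ((harmonic j : ℝ) + ((j : ℝ) + 1)⁻¹)) =
        ((j : ℝ) + 1) * (2 * (n : ℝ) ^ 2 * (harmonic j : ℝ)) + 2 * (n : ℝ) ^ 2 := by
      field_simp
    nlinarith [sq_nonneg ((n : ℝ) - (j + 1) - 1), sq_nonneg ((j : ℝ) - 2)]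

/-- The bound on the potential after a card of colour `0` is inserted with `f` colour changes
above it, where `d` colour changes precede the first pair of equal neighbours. For `f < d` it is
an equality. -/
noncomputable def insertBound (n k d : ℕ) (f : ℕ) : ℝ :=
  base n k + (f + d) / 2 - curv n k * ((f : ℝ) - d) ^ 2

/-- An inserted card that keeps the tier. With `u` and `v` the parts of the word above and below the
new entry `true`, either `u` has no entry `true`, and the first pair is the new one, or the first
pair is in `u`, and the new one bounds the distance to the second pair. -/
lemma pot_insert_le {n k m : ℕ} (hk : 1 ≤ k) (hm : 1 ≤ m) (hmk : m + k = n) {u v : List Bool}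
    (hT : (u ++ v).count true + 1 = 2 * k) (hF : (u ++ v).count false = 2 * m) :
    pot n (u ++ true :: v) ≤ insertBound n k (lead (u ++ v)) (u.count false) := by
  have hT' : (u ++ true :: v).count true = 2 * k := by
    simp only [List.count_append, List.count_cons_self] at hT ⊢
    omega
  rw [pot, if_neg (by omega), hT', Nat.mul_div_cancel_left k (by norm_num)]
  by_cases hu : true ∈ u
  · rw [lead_append_of_mem hu, afterFirst_append_of_mem hu, lead_append_of_mem hu]
    have h1 := lead_append_true_le (afterFirst u) v
    have h2 := lead_add_count_afterFirst hu
    have h3 : u.count false ≤ 2 * m := by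
      rw [← hF, List.count_append]; omega
    have h4 := rPot_mono k (by omega : 2 ≤ n) h1 (by omega)
    refine (add_le_add_right h4 _).trans (le_of_eq ?_)
    unfold rPot insertBound
    rw [← h2]
    push_cast
    ring
  · rw [lead_append_of_notMem hu, afterFirst_append_of_notMem hu, lead_append_of_notMem hu]
    simp only [lead, afterFirst, add_zero]
    unfold rPot insertBound
    push_cast
    apply le_of_eq
    ring

lemma sum_insertBound (n k d m : ℕ) :
    ∑ f ∈ Finset.Ico 0 (2 * m), insertBound n k d (2 * ((f + 1) / 2)) +
        insertBound n k d (2 * m) =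
      (2 * m + 1) * (base n k + d / 2) + m * (m + 1) - curv n k *
        (4 / 3 * m * (m + 1) * (2 * m + 1) - 4 * d * m * (m + 1) + (2 * m + 1) * (d : ℝ) ^ 2) := by
  rw [Nat.Ico_zero_eq_range]
  induction m with
  | zero => simp [insertBound]
  | succ m ih =>
    rw [show 2 * (m + 1) = 2 * m + 1 + 1 by ring, Finset.sum_range_succ, Finset.sum_range_succ,
      show 2 * ((2 * m + 1) / 2) = 2 * m by omega,
      show 2 * ((2 * m + 1 + 1) / 2) = 2 * m + 1 + 1 by omega, ih]
    unfold insertBound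
    push_cast
    ring

lemma insertIdx_eq_take_drop (l : List Bool) (b : Bool) {j : ℕ} (hj : j ≤ l.length) :
    l.insertIdx j b = l.take j ++ b :: l.drop j := by
  induction l generalizing j with
  | nil => simp_all
  | cons a l ih =>
    cases j with
    | zero => rfl
    | succ j => simp [ih (by simpa using hj)]

lemma even_count_false_adj (a : Bool) (l : List Bool) (h : bottom a l = a) :
    Even ((adj a l).count false) := by
  have := two_mul_count_add a a l
  rw [h] at this
  exact ⟨l.count a - pairs a a l, by omega⟩

/-- The balance of colours in a random deck `false :: l`: among the pairs of equal neighbours,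
one more has colour `1` than colour `0` once the pair at the cut is left aside. -/
lemma pairs_of_balanced {n m : ℕ} {l : List Bool} (hlast : bottom false l = false)
    (h0 : l.count false + 1 = n) (h1 : l.count true = n)
    (hF : (adj false l).count false = 2 * m) :
    pairs false false l + m + 1 = n ∧ pairs true false l + m = n := by
  have e0 := two_mul_count_add false false l
  have e1 := two_mul_count_add true false l
  rw [hlast, hF] at e0 e1
  omega

/-- Inserting the top card inside a block of colour `1` lowers the tier by one. -/
lemma pot_drop_le {n k m : ℕ} (hk : 1 ≤ k) (hmk : m + k = n) {l₁ l₂ : List Bool}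
    (h0 : (l₁ ++ true :: l₂).count false + 1 = n) (h1 : (l₁ ++ true :: l₂).count true = n)
    (hF : (adj false (l₁ ++ true :: l₂)).count false = 2 * m)
    (hlast : bottom false (l₁ ++ true :: l₂) = false) (hl₁ : bottom false l₁ = true) :
    pot n (adj false (l₁ ++ false :: true :: l₂)) ≤
      if k = 1 then 0
      else base n (k - 1) + 2 * m + 1 + (lead (adj false (l₁ ++ true :: l₂)) : ℝ) / 2 := by
  have hw : adj false (l₁ ++ true :: l₂) = adj false l₁ ++ true :: adj true l₂ := by
    rw [adj_append, hl₁]; rfl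
  have hv : adj false (l₁ ++ false :: true :: l₂) =
      adj false l₁ ++ false :: false :: adj true l₂ := by
    rw [adj_append, hl₁]; rfl
  have hp := pairs_of_balanced hlast h0 h1 hF
  have hT := pairs_add_pairs false (l₁ ++ true :: l₂)
  have hTv : (adj false (l₁ ++ false :: true :: l₂)).count true + 2 = 2 * k := by
    rw [hw] at hT
    rw [hv]
    simp at hT ⊢
    omega
  have hFv : (adj false (l₁ ++ false :: true :: l₂)).count false = 2 * m + 2 := by
    rw [hw] at hF
    rw [hv]
    simp at hF ⊢
    omega
  have hlead := count_of_lead_eq false (l₁ ++ false :: true :: l₂)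
  have hle := lead_le_count (adj false (l₁ ++ false :: true :: l₂))
  have hcount : (l₁ ++ false :: true :: l₂).count false =
      (l₁ ++ false :: true :: l₂).count true := by
    simp at h0 h1 ⊢
    omega
  split_ifs with hk1
  · rw [pot, if_pos (by omega)]
  · rw [pot, if_neg (by omega), show (adj false (l₁ ++ false :: true :: l₂)).count true / 2 = k - 1
      by omega]
    have hmem : true ∈ adj false (l₁ ++ false :: true :: l₂) := List.count_pos_iff.1 (by omega)
    have hsum := lead_add_lead_afterFirst_le hmem
    have hlt : lead (adj false (l₁ ++ false :: true :: l₂)) ≤ 2 * m + 1 := by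
      by_contra hcon
      have h' := (hlead (by omega)).1 (by rw [hFv]; exact ⟨m + 1, by ring⟩)
      simp only [Bool.not_false] at h'
      omega
    -- When the top block stays a pair of equal neighbours, no move is spent on rotations.
    have hzero : lead (adj false (l₁ ++ true :: l₂)) = 0 →
        lead (adj false (l₁ ++ false :: true :: l₂)) = 0 := by
      rw [hw, hv]
      rcases l₁ with _ | ⟨_ | _, l₁⟩
      · simp [bottom] at hl₁
      · simp [adj, lead]
      · simp [adj, lead]
    have hr := rPot_le n (k - 1) (lead (afterFirst (adj false (l₁ ++ false :: true :: l₂))))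
      (by omega)
    have hineq : 2 * lead (adj false (l₁ ++ false :: true :: l₂)) +
        lead (afterFirst (adj false (l₁ ++ false :: true :: l₂))) ≤
        4 * m + 2 + lead (adj false (l₁ ++ true :: l₂)) := by omega
    have hineq' : 2 * (lead (adj false (l₁ ++ false :: true :: l₂)) : ℝ) +
        lead (afterFirst (adj false (l₁ ++ false :: true :: l₂))) ≤
        4 * m + 2 + lead (adj false (l₁ ++ true :: l₂)) := by exact_mod_cast hineq
    linarith

/-- At a random deck the potential exceeds its average after the next move by at least one. -/
theorem pot_random_step {n k m : ℕ} (hk : 1 ≤ k) (hm : 1 ≤ m) (hmk : m + k = n) {l : List Bool}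
    (hlast : bottom false l = false) (h0 : l.count false + 1 = n) (h1 : l.count true = n)
    (hF : (adj false l).count false = 2 * m) :
    2 * n + ∑ j ∈ Finset.range (2 * n), pot n (adj false (l.insertIdx j false)) ≤
      2 * n * rPot n k (lead (adj false l)) := by
  have hp := pairs_of_balanced hlast h0 h1 hF
  have hT := pairs_add_pairs false l
  have hlen : l.length + 1 = 2 * n := by
    have := List.count_false_add_count_true l
    omega
  set d := lead (adj false l) with hd
  have hc0 := curv_nonneg n k (by omega)
  have hsum := sum_insert_le (l := l) (fun l₁ l₂ => pot n (adj false (l₁ ++ false :: l₂)))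
    (insertBound n k d) (if k = 1 then 0 else base n (k - 1) + 2 * m + 1 + (d : ℝ) / 2)
    (base n k + (2 * m + d) / 2)
    (fun l₁ l₂ hl hl₁ => by
      have e1 : adj false l = adj false l₁ ++ adj false l₂ := by rw [hl, adj_append, hl₁]
      have e2 : adj false (l₁ ++ false :: l₂) = adj false l₁ ++ true :: adj false l₂ := by
        rw [adj_append, hl₁]; rfl
      rw [e2, hd, e1]
      exact pot_insert_le hk hm hmk (by rw [← e1]; omega) (by rw [← e1]; omega))
    (fun l₁ l₂ => by simp)
    (fun l₁ l₂ hl hl₁ => by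
      subst hl
      exact pot_drop_le hk hmk h0 h1 hF hlast hl₁)
    (fun f hf => by
      rw [hF] at hf
      have : (f : ℝ) ≤ 2 * m := by exact_mod_cast hf
      have := mul_nonneg hc0 (sq_nonneg ((f : ℝ) - d))
      unfold insertBound
      linarith)
    hlast [] l rfl
  have hGsum : ∑ j ∈ Finset.range (2 * n), pot n (adj false (l.insertIdx j false)) =
      ∑ j ∈ Finset.range (l.length + 1),
        pot n (adj false (([] ++ l.take j) ++ false :: l.drop j)) := by
    rw [hlen]
    refine Finset.sum_congr rfl fun j hj => ?_
    rw [insertIdx_eq_take_drop _ _ (by have := Finset.mem_range.1 hj; omega)]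
    rfl
  have hadj : (adj false []).count false = 0 := rfl
  have hbot : bottom false [] = false := rfl
  rw [hadj, hF, sum_insertBound, hbot] at hsum
  rw [hGsum]
  have hpf : (pairs false false l : ℝ) = k - 1 := by
    have : pairs false false l + 1 = k := by omega
    rw [← this]; push_cast; ring
  have hpt : (pairs true false l : ℝ) = k := by
    have : pairs true false l = k := by omega
    rw [this]
  have hmn : (m : ℝ) = n - k := by rw [← hmk]; push_cast; ring
  rw [hpf, hpt] at hsum
  have hd2 : (d : ℝ) ≤ 2 * m := by
    have := lead_le_count (adj false l)
    rw [hF] at this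
    exact_mod_cast this
  have hm1 : (1 : ℝ) ≤ m := by exact_mod_cast hm
  have hd0 : (0 : ℝ) ≤ d := by positivity
  unfold rPot
  by_cases hk1 : k = 1
  · subst hk1
    rw [if_pos rfl] at hsum
    have hcm : curv n 1 * (8 * n * (n - 1)) = 1 := by
      have : (0 : ℝ) < n - 1 := by push_cast at hmn; linarith
      have : (0 : ℝ) < n := by linarith
      rw [curv, if_pos rfl, one_div, inv_mul_cancel₀ (by positivity)]
    have hmn' : (n : ℝ) = m + 1 := by push_cast at hmn; linarith
    have hcm' : curv n 1 * (8 * (m + 1) * m) = 1 := by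
      rw [hmn'] at hcm
      linear_combination hcm
    have hb : base n 1 = (m + 1 : ℝ) ^ 2 + 2 * (m + 1) / 3 + 2 / 3 := by
      rw [base, if_pos rfl, hmn']
    have hcd : curv n 1 * (d : ℝ) ^ 2 ≤ 1 / 2 := by
      have : (d : ℝ) ^ 2 ≤ 4 * (m + 1) * m := by nlinarith
      have := mul_le_mul_of_nonneg_left this hc0
      nlinarith
    have e1 : curv n 1 * (4 / 3 * m * (m + 1) * (2 * m + 1) - 4 * d * m * (m + 1) +
        (2 * m + 1) * (d : ℝ) ^ 2) =
        (2 * m + 1) / 6 - d / 2 + (2 * m + 1) * (curv n 1 * (d : ℝ) ^ 2) := by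
      linear_combination ((2 * (m : ℝ) + 1) / 6 - d / 2) * hcm'
    rw [e1, hb] at hsum
    rw [hb, hmn']
    push_cast at hsum
    nlinarith
  · rw [if_neg hk1] at hsum
    have hstep := base_step (by omega : 2 ≤ k) (by omega : k < n)
    have hcz : curv n k = 0 := if_neg hk1
    rw [hcz] at hsum ⊢
    rw [← hmn] at hstep
    have hn' : (n : ℝ) = m + k := by rw [hmn]; ring
    have hk0 : (0 : ℝ) ≤ k := by positivity
    rw [hn'] at hstep ⊢
    nlinarith

/-! ### The potential of a deck -/

lemma bottom_eq_of_ne_nil {l : List Bool} (h : l ≠ []) (a b : Bool) : bottom a l = bottom b l := by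
  cases l with
  | nil => exact absurd rfl h
  | cons => rfl

lemma getLast?_cons_eq_bottom (a : Bool) (l : List Bool) :
    (a :: l).getLast? = some (bottom a l) := by
  induction l generalizing a with
  | nil => rfl
  | cons b l ih => rw [List.getLast?_cons_cons, ih]; rfl

/-- Compared with a bottom card of colour `1`, the alternating deck has no equal neighbours. -/
lemma adj_alternatingCards (n : ℕ) :
    (adj true (Deck.alternatingCards n)).count true = 0 := by
  induction n with
  | zero => rfl
  | succ n ih => simpa [Deck.alternatingCards, adj] using ih

/-- Each block of colour `1` accounts for two changes of colour, up to the ends of the deck. -/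
lemma two_mul_countP_splitBy_loop (l : List Bool) (a : Bool) (g : List Bool)
    (gs : List (List Bool)) (hg : ∀ b ∈ g, b = a) :
    2 * (List.splitBy.loop (fun a b => a == b) l a g gs).countP (fun b => true ∈ b) =
      2 * gs.countP (fun b => true ∈ b) + (adj a l).count false +
        a.toNat + (bottom a l).toNat := by
  induction l generalizing a g gs with
  | nil =>
    have : (true ∈ g ∨ true = a) ↔ a = true := by
      constructor
      · rintro (h | h)
        · exact (hg _ h).symm
        · exact h.symm
      · rintro rfl; exact Or.inr rfl
    cases a <;> simp_all [List.splitBy.loop, adj, bottom]; omega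
  | cons b l ih =>
    by_cases hab : a = b
    · subst hab
      have := ih a (a :: g) gs (by simpa using hg)
      simp only [List.splitBy.loop, BEq.rfl, adj, bottom] at this ⊢
      simpa using this
    · have hab' : (a == b) = false := by simpa using hab
      have := ih b [] ((a :: g).reverse :: gs) (by simp)
      simp only [List.splitBy.loop, hab', adj, bottom]
      rw [this, List.countP_cons]
      have hmem : (true ∈ (a :: g).reverse) ↔ a = true := by
        rw [List.mem_reverse, List.mem_cons]
        constructor
        · rintro (h | h)
          · exact h.symm
          · exact (hg _ h).symm
        · rintro rfl; exact Or.inl rfl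
      cases a <;> cases b <;> simp_all <;> omega

namespace Deck

variable {n : ℕ}

lemma exists_cards_eq (D : Deck n) : ∃ l, D.cards = false :: l := by
  have h := D.head_eq
  cases hc : D.cards with
  | nil => rw [hc] at h; simp at h
  | cons a l => rw [hc] at h; simp at h; exact ⟨l, by rw [h]⟩

lemma isRandom_iff {D : Deck n} {l : List Bool} (h : D.cards = false :: l) :
    D.IsRandom ↔ bottom false l = false := by
  unfold IsRandom
  rw [h, getLast?_cons_eq_bottom, List.head?_cons, Option.some_inj]
  exact eq_comm

lemma bottom_cyc (D : Deck n) : bottom (bottom false D.cards) D.cards = bottom false D.cards :=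
  bottom_eq_of_ne_nil D.cards_ne_nil _ _

/-- If the first pair of equal neighbours came after all the colour changes, the colours of the
deck would not be balanced. -/
lemma lead_lt_count [NeZero n] (D : Deck n) (h : (cyc D.cards).count true ≠ 0) :
    lead (cyc D.cards) < (cyc D.cards).count false := by
  refine lt_of_le_of_ne (lead_le_count _) fun hlead => ?_
  have h1 := (count_of_lead_eq _ _ hlead).1 (even_count_false_adj _ _ D.bottom_cyc)
  have h2 : ∀ b, D.cards.count b = n := fun b => by
    cases b
    · exact D.count_false
    · exact D.count_true
  rw [h2, h2] at h1
  exact h (by rw [cyc]; omega)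

/-- Every deck has `m ≥ 1` blocks of each colour around the cycle, and lies on tier `k = n - m`. -/
lemma exists_tier [NeZero n] (D : Deck n) : ∃ m k, 1 ≤ m ∧ m + k = n ∧
    (cyc D.cards).count false = 2 * m ∧ (cyc D.cards).count true = 2 * k := by
  have hlen : (cyc D.cards).length = 2 * n := by rw [cyc, length_adj, D.length_cards]
  have hsum := List.count_false_add_count_true (cyc D.cards)
  obtain ⟨m, hm⟩ := even_count_false_adj _ _ D.bottom_cyc
  rw [← cyc] at hm
  have hn := NeZero.pos n
  have hm0 : 1 ≤ m := by
    by_contra hcon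
    have := D.lead_lt_count (by omega)
    omega
  exact ⟨m, n - m, hm0, by omega, by omega, by omega⟩

lemma two_mul_numOneBlocks (D : Deck n) : 2 * D.numOneBlocks = (cyc D.cards).count false := by
  obtain ⟨l, hl⟩ := D.exists_cards_eq
  unfold numOneBlocks blocks
  rw [hl, List.splitBy, two_mul_countP_splitBy_loop l false [] [] (by simp), cyc_cons]
  cases bottom false l <;> simp

/-- The potential of a deck, as an extended nonnegative number. -/
noncomputable def potential (D : Deck n) : ℝ≥0∞ := ENNReal.ofReal (pot n (cyc D.cards))

lemma pot_cyc_nonneg [NeZero n] (D : Deck n) : 0 ≤ pot n (cyc D.cards) := by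
  obtain ⟨m, k, hm, hmk, hF, hT⟩ := D.exists_tier
  exact pot_nonneg (by omega) (by rw [cyc, length_adj, D.length_cards]) (by omega)

lemma cyc_insertTop {D : Deck n} {l : List Bool} (h : D.cards = false :: l)
    (hlast : bottom false l = false) (j : Fin (2 * n)) :
    cyc (D.insertTop j).cards = adj false (l.insertIdx j false) := by
  have hlen := D.length_cards
  have hj : (j : ℕ) ≤ l.length := by
    rw [h, List.length_cons] at hlen
    omega
  have h1 : (D.insertTop j).cards = foldCards (l.insertIdx j false) := by
    simp only [insertTop, reorder, h, List.tail_cons, List.head_cons]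
  rw [h1, cyc_foldCards, cyc, insertIdx_eq_take_drop l false hj]
  congr 1
  rw [bottom_append]
  rw [← List.take_append_drop j l, bottom_append] at hlast
  rcases hd : l.drop j with _ | ⟨b, l'⟩
  · rfl
  · rw [hd] at hlast
    exact hlast

lemma cyc_topToBottom {D : Deck n} {l : List Bool} (h : D.cards = false :: l)
    (hlast : bottom false l = true) : cyc D.topToBottom.cards = adj false l ++ [false] := by
  have h1 : D.topToBottom.cards = foldCards (l ++ [false]) := by
    simp [topToBottom, reorder, h]
  rw [h1, cyc_foldCards, cyc_rotate, hlast]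
  rfl

/-- A move to the bottom brings the next random deck one move closer and does not affect the rest
of the potential. -/
lemma pot_rotate {v : List Bool} (h : 2 ≤ v.count true) :
    pot n (false :: v) = 1 + pot n (v ++ [false]) := by
  have hv : true ∈ v := List.count_pos_iff.1 (by omega)
  have hc := count_true_afterFirst hv
  have hv' : true ∈ afterFirst v := List.count_pos_iff.1 (by omega)
  have h1 : (false :: v).count true = v.count true := by simp
  have h2 : (v ++ [false]).count true = v.count true := by simp
  rw [pot, pot, h1, h2, if_neg (by omega), if_neg (by omega), lead_append_of_mem hv,
    afterFirst_append_of_mem hv, lead_append_of_mem hv']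
  simp only [lead, afterFirst]
  push_cast
  ring

lemma eq_alternating [NeZero n] {D : Deck n} (h : (cyc D.cards).count true = 0) :
    D = alternating n := by
  obtain ⟨l, hl⟩ := D.exists_cards_eq
  have hb : bottom false D.cards = true := by
    by_contra hb
    rw [Bool.not_eq_true] at hb
    rw [hl] at hb h
    rw [cyc_cons] at h
    have hb' : bottom false l = false := hb
    simp [hb'] at h
  refine Deck.ext (eq_of_adj_count_true_eq_zero (a := true) ?_ (adj_alternatingCards n) ?_)
  · rwa [cyc, hb] at h
  · rw [D.length_cards]; exact (alternating n).length_cards.symm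

/-- The potential satisfies the hypothesis of `expectedTime_le_of_superharmonic`. -/
lemma potential_superharmonic [NeZero n] (D : Deck n) (hD : D ≠ alternating n) :
    1 + ∫⁻ E, E.potential ∂(moveKernel n D) ≤ D.potential := by
  obtain ⟨l, hl⟩ := D.exists_cards_eq
  obtain ⟨m, k, hm, hmk, hF, hT⟩ := D.exists_tier
  have hk : 1 ≤ k := by
    by_contra hcon
    exact hD (eq_alternating (by omega))
  have hn : (0 : ℝ) < n := by exact_mod_cast NeZero.pos n
  rw [hl, cyc_cons] at hF hT
  by_cases hr : D.IsRandom
  · have hlast := (isRandom_iff hl).1 hr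
    have h0 := D.count_false
    have h1 := D.count_true
    rw [hl] at h0 h1
    rw [hlast] at hF hT
    simp at h0 h1 hF hT
    have hstep := pot_random_step hk hm hmk hlast h0 h1 hF
    rw [lintegral_moveKernel_of_isRandom _ hr]
    have hpot : pot n (cyc D.cards) = rPot n k (lead (adj false l)) := by
      rw [hl, cyc_cons, hlast, pot]
      have hT' : ((false == false) :: adj false l).count true = 2 * k := by simpa using hT
      rw [hT', if_neg (by omega), Nat.mul_div_cancel_left k (by norm_num)]
      simp [lead, afterFirst]
    have hsum : ∑ j : Fin (2 * n), (D.insertTop j).potential =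
        ENNReal.ofReal (∑ j ∈ Finset.range (2 * n), pot n (adj false (l.insertIdx j false))) := by
      rw [← Fin.sum_univ_eq_sum_range (fun j => pot n (adj false (l.insertIdx j false))),
        ENNReal.ofReal_sum_of_nonneg]
      · exact Finset.sum_congr rfl fun j _ => by rw [potential, cyc_insertTop hl hlast]
      · intro j _
        rw [← cyc_insertTop hl hlast]
        exact pot_cyc_nonneg _
    have hnn : 0 ≤ ∑ j ∈ Finset.range (2 * n), pot n (adj false (l.insertIdx j false)) := by
      rw [← Fin.sum_univ_eq_sum_range (fun j => pot n (adj false (l.insertIdx j false)))]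
      refine Finset.sum_nonneg fun j _ => ?_
      rw [← cyc_insertTop hl hlast]
      exact pot_cyc_nonneg _
    rw [hsum, potential, hpot, ← ENNReal.ofReal_natCast, ← ENNReal.ofReal_div_of_pos
      (by push_cast; positivity), ← ENNReal.ofReal_one, ← ENNReal.ofReal_add zero_le_one
      (by positivity)]
    refine ENNReal.ofReal_le_ofReal ?_
    push_cast
    rw [← mul_le_mul_iff_right₀ (show (0 : ℝ) < 2 * n by positivity), mul_add,
      mul_div_cancel₀ _ (by positivity : (2 * n : ℝ) ≠ 0)]
    linarith
  · have hlast : bottom false l = true := by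
      simpa using fun h => hr ((isRandom_iff hl).2 h)
    rw [lintegral_moveKernel_of_not_isRandom _ hr, potential, potential,
      cyc_topToBottom hl hlast, hl, cyc_cons, hlast]
    rw [hlast] at hT
    have hT' : (adj false l).count true = 2 * k := by simpa using hT
    have hrot := pot_rotate (n := n) (v := adj false l) (by omega)
    have hnn := D.topToBottom.pot_cyc_nonneg
    rw [cyc_topToBottom hl hlast] at hnn
    rw [show (true == false) = false from rfl, hrot, ENNReal.ofReal_add zero_le_one hnn,
      ENNReal.ofReal_one]

theorem expectedTime_le_potential [NeZero n] (D : Deck n) : expectedTime D ≤ D.potential :=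
  expectedTime_le_of_superharmonic potential potential_superharmonic D

lemma base_le {k : ℕ} : base n k ≤ tierBound n k - (n - k - 1 / 2) := by
  unfold base
  split_ifs with h
  · subst h
    norm_num [tierBound, harmonic]
    linarith
  · exact le_rfl

lemma InTier.count {k : ℕ} {D : Deck n} (h : D.InTier k) :
    (cyc D.cards).count false + 2 * k = 2 * n ∧ (cyc D.cards).count true = 2 * k := by
  have h1 := D.two_mul_numOneBlocks
  have hlen : (cyc D.cards).length = 2 * n := by rw [cyc, length_adj, D.length_cards]
  have hsum := List.count_false_add_count_true (cyc D.cards)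
  unfold InTier at h
  omega

lemma pot_le_of_isRandom {k : ℕ} (hk : 1 ≤ k) (hkn : k < n) {D : Deck n}
    (hD : D.InTier k) (hr : D.IsRandom) : pot n (cyc D.cards) ≤ tierBound n k := by
  obtain ⟨l, hl⟩ := D.exists_cards_eq
  obtain ⟨hF, hT⟩ := hD.count
  have hlast := (isRandom_iff hl).1 hr
  have h0 := D.count_false
  have h1 := D.count_true
  rw [pot, hT, if_neg (by omega), Nat.mul_div_cancel_left k (by norm_num)]
  rw [hl, cyc_cons, hlast] at hF ⊢
  rw [hl] at h0 h1
  simp at h0 h1 hF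
  simp only [BEq.rfl, lead, afterFirst, Nat.cast_zero, zero_add]
  have hd : lead (adj false l) < (adj false l).count false := by
    refine lt_of_le_of_ne (lead_le_count _) fun hlead => ?_
    have := (count_of_lead_eq _ _ hlead).1 (even_count_false_adj _ _ hlast)
    rw [Bool.not_false] at this
    omega
  have hd' : lead (adj false l) + 1 + 2 * k ≤ 2 * n := by omega
  have hd'' : (lead (adj false l) : ℝ) + 1 + 2 * k ≤ 2 * n := by exact_mod_cast hd'
  have h2 := rPot_le n k (lead (adj false l)) (by omega)
  have h3 := base_le (n := n) (k := k)
  linarith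

lemma pot_le [NeZero n] {k : ℕ} (hk : 1 ≤ k) (hkn : k < n) {D : Deck n} (hD : D.InTier k) :
    pot n (cyc D.cards) ≤ tierBound n k + 2 * n - 2 * k - 1 := by
  obtain ⟨hF, hT⟩ := hD.count
  have hp := D.lead_lt_count (by omega)
  have hpq := lead_add_lead_afterFirst_le
    (List.count_pos_iff.1 (by omega : 0 < (cyc D.cards).count true))
  rw [pot, hT, if_neg (by omega), Nat.mul_div_cancel_left k (by norm_num)]
  have h2 := rPot_le n k (lead (afterFirst (cyc D.cards))) (by omega)
  have h3 := base_le (n := n) (k := k)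
  have h4 : (lead (cyc D.cards) : ℝ) + 1 + 2 * k ≤ 2 * n := by
    exact_mod_cast (by omega : lead (cyc D.cards) + 1 + 2 * k ≤ 2 * n)
  have h5 : (lead (cyc D.cards) : ℝ) + lead (afterFirst (cyc D.cards)) + 2 * k ≤ 2 * n := by
    exact_mod_cast
      (by omega : lead (cyc D.cards) + lead (afterFirst (cyc D.cards)) + 2 * k ≤ 2 * n)
  have h6 : (k : ℝ) + 1 ≤ n := by exact_mod_cast hkn
  linarith

end Deck

end CardShuffle

/-- For `1 ≤ k < n`, the maximal expected absorption times over tier `k` are finite and satisfy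
the stated bounds, both over the random decks and over all decks of the tier. -/
theorem mainTheorem1 (n k : ℕ) [NeZero n] (hk : 1 ≤ k) (hkn : k < n) :
    (CardShuffle.maxRandomTime n k ≠ ⊤ ∧
      (CardShuffle.maxRandomTime n k).toReal ≤
        2 * (n : ℝ) ^ 2 * (harmonic k : ℝ) - (n : ℝ) ^ 2 - (n : ℝ) * ((k : ℝ) - 8 / 3)) ∧
    (CardShuffle.maxTime n k ≠ ⊤ ∧
      (CardShuffle.maxTime n k).toReal ≤
        2 * (n : ℝ) ^ 2 * (harmonic k : ℝ) - (n : ℝ) ^ 2 - (n : ℝ) * ((k : ℝ) - 14 / 3)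
          - 2 * (k : ℝ) - 1) := by
  have hle : ∀ D : CardShuffle.Deck n, ∀ B : ℝ,
      CardShuffle.pot n (CardShuffle.cyc D.cards) ≤ B →
      CardShuffle.expectedTime D ≤ ENNReal.ofReal B :=
    fun D B h => D.expectedTime_le_potential.trans (ENNReal.ofReal_le_ofReal h)
  have h1 : CardShuffle.maxRandomTime n k ≤ ENNReal.ofReal (CardShuffle.tierBound n k) :=
    iSup₂_le fun D hD => hle D _ (D.pot_le_of_isRandom hk hkn hD.1 hD.2)
  have h2 : CardShuffle.maxTime n k ≤
      ENNReal.ofReal (CardShuffle.tierBound n k + 2 * n - 2 * k - 1) :=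
    iSup₂_le fun D hD => hle D _ (D.pot_le hk hkn hD)
  have hkn' : (k : ℝ) + 1 ≤ n := by exact_mod_cast hkn
  have hpos : 0 ≤ CardShuffle.tierBound n k :=
    le_trans (by nlinarith) (CardShuffle.le_tierBound (n := n) hk)
  refine ⟨⟨ne_top_of_le_ne_top ENNReal.ofReal_ne_top h1, ?_⟩,
    ne_top_of_le_ne_top ENNReal.ofReal_ne_top h2, ?_⟩
  · exact ENNReal.toReal_le_of_le_ofReal hpos h1
  · refine (ENNReal.toReal_le_of_le_ofReal (by linarith) h2).trans (le_of_eq ?_)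
    unfold CardShuffle.tierBound
    ring
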